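/- **Theorem 5 (quaternion QCQP with four constraints).** Let $\mathbb H$ be the quaternions, $n\ge 0$, let $Q,A_1,\dots,A_4\in\mathbb H^{n\times n}$ be Hermitian, $q,b_1,\dots,b_4\in\mathbb H^n$ and $c_1,\dots,c_4\in\mathbb R$. Consider $$\text{(QCQP)}\qquad \max_{x\in\mathbb H^n}\ x^HQx+2\,\mathrm{Re}(x^Hq)\quad\text{s.t.}\quad x^HA_jx+2\,\mathrm{Re}(x^Hb_j)+c_j\le 0,\quad j=1,2,3,4.$$ For $A,B\in\mathbb H^{N\times N}$ write $A\bullet B=\mathrm{Re}\,\mathrm{tr}(A^HB)$, let $X\succeq 0$ mean that $X=X^H$ and $u^HXu\ge 0$ for all $u$, and let the rank of a quaternion matrix be the dimension of its column space as a right $\mathbb H$-vector space. Put $$B_0=\begin{bmatrix}0&q^H\\ q&Q\end{bmatrix},\qquad B_j=\begin{bmatrix}c_j&b_j^H\\ b_j&A_j\end{bmatrix}\ (j=1,2,3,4),\qquad B_5=\begin{bmatrix}1&0\\0&0\end{bmatrix},$$ all in $\mathbb H^{(n+1)\times(n+1)}$, and consider the SDP relaxation $$\text{(QCQPR)}\qquad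 \max_X\ B_0\bullet X\quad\text{s.t.}\quad B_j\bullet X\le 0\ (j=1,2,3,4),\quad B_5\bullet X=1,\quad X\succeq 0.$$ Suppose that the Slater condition holds: there is $x_0\in\mathbb H^n$ with $x_0^HA_jx_0+2\,\mathrm{Re}(x_0^Hb_j)+c_j<0$ for $j=1,2,3,4$. Then: 1. (QCQP) and (QCQPR) have the same optimal value, i.e. the suprema of their objectives over their feasible sets agree (possibly both are $+\infty$). 2. Let $X^*$ be an optimal solution of (QCQPR) and $r=\mathrm{rank}\,X^*$. Then there are vectors $\tilde x_k=\begin{pmatrix}t_k\\x_k\end{pmatrix}$ with $t_k\in\mathbb H$, $x_k\in\mathbb H^n$, $k=1,\dots,r$, such that $$X^*=\sum_{k=1}^r\tilde x_k\tilde x_k^H\quad\text{and}\quad \tilde x_k^HB_j\tilde x_k=\frac{B_j\bullet X^*}{r}\qquad(j=1,2,3,4,\ k=1,\dots,r).$$ For any such vectors there is an index $\ell$ with $t_\ell\ne 0$, and for every $\ell$ with $t_\ell\neq 0$ the vector $x_\ell\cdot t_\ell^{-1}$ is an optimal solution of (QCQP). -/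

import Mathlib

open scoped Quaternion Matrix

noncomputable section

/-- The rank of a quaternion matrix: the dimension of its column space, a right
`ℍ`-vector space (that is, a module over `ℍᵐᵒᵖ`). -/
def quaternionRank {ι κ : Type*} (X : Matrix ι κ ℍ[ℝ]) : ℕ :=
  Module.finrank ℍ[ℝ]ᵐᵒᵖ (Submodule.span ℍ[ℝ]ᵐᵒᵖ (Set.range Xᵀ))

/-- The real inner product `A • B = Re tr (Aᴴ B)`. -/
def quaternionInner {ι : Type*} [Fintype ι] (A B : Matrix ι ι ℍ[ℝ]) : ℝ :=
  (Aᴴ * B).trace.re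

/-- `X ⪰ 0`: `X` is Hermitian and `uᴴ X u ≥ 0` for all `u` (this number is then real).
Mathlib's `Matrix.PosSemidef` is not available, as it has no order on the quaternions. -/
def QuaternionPosSemidef {ι : Type*} [Fintype ι] (X : Matrix ι ι ℍ[ℝ]) : Prop :=
  X.IsHermitian ∧ ∀ u : ι → ℍ[ℝ], 0 ≤ (star u ⬝ᵥ (X *ᵥ u)).re

/-- With `r = rank X`, the vectors `v 1, …, v r` satisfy `X = ∑ₖ vₖ vₖᴴ` and
`vₖᴴ Bⱼ vₖ = (Bⱼ • X) / r` for all `j` and `k`. -/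
structure IsRankOneDecomposition {ι : Type*} [Fintype ι] {m : ℕ}
    (B : Fin m → Matrix ι ι ℍ[ℝ]) (X : Matrix ι ι ℍ[ℝ])
    (v : Fin (quaternionRank X) → ι → ℍ[ℝ]) : Prop where
  sum_eq : X = ∑ k, Matrix.vecMulVec (v k) (star (v k))
  form_eq : ∀ j k, star (v k) ⬝ᵥ (B j *ᵥ v k) =
    ((quaternionInner (B j) X / (quaternionRank X : ℝ) : ℝ) : ℍ[ℝ])

/-- The data of the problem
`max xᴴ Q x + 2 Re (xᴴ q)` subject to `xᴴ Aⱼ x + 2 Re (xᴴ bⱼ) + cⱼ ≤ 0`, `j = 1, …, m`,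
over `x ∈ ℍⁿ`, with `Q` and `Aⱼ` Hermitian. -/
structure QuaternionQCQP (n m : ℕ) where
  Q : Matrix (Fin n) (Fin n) ℍ[ℝ]
  q : Fin n → ℍ[ℝ]
  A : Fin m → Matrix (Fin n) (Fin n) ℍ[ℝ]
  b : Fin m → Fin n → ℍ[ℝ]
  c : Fin m → ℝ
  Q_hermitian : Q.IsHermitian
  A_hermitian : ∀ j, (A j).IsHermitian

/-- The block matrix `[c, bᴴ; b, A]`. -/
def borderedMatrix {n : ℕ} (c : ℝ) (b : Fin n → ℍ[ℝ]) (A : Matrix (Fin n) (Fin n) ℍ[ℝ]) :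
    Matrix (Unit ⊕ Fin n) (Unit ⊕ Fin n) ℍ[ℝ] :=
  Matrix.fromBlocks (Matrix.of fun _ _ => (c : ℍ[ℝ])) (Matrix.replicateRow Unit (star b))
    (Matrix.replicateCol Unit b) A

/-- The vector `x · t⁻¹ ∈ ℍⁿ` obtained from `(t, x) ∈ ℍⁿ⁺¹` (for `t ≠ 0`). -/
def dehomogenize {n : ℕ} (w : Unit ⊕ Fin n → ℍ[ℝ]) : Fin n → ℍ[ℝ] :=
  fun i => w (Sum.inr i) * (w (Sum.inl ()))⁻¹

namespace QuaternionQCQP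

variable {n m : ℕ} (P : QuaternionQCQP n m)

/-- `xᴴ Q x + 2 Re (xᴴ q)`. -/
def objective (x : Fin n → ℍ[ℝ]) : ℝ :=
  (star x ⬝ᵥ (P.Q *ᵥ x)).re + 2 * (star x ⬝ᵥ P.q).re

/-- `xᴴ Aⱼ x + 2 Re (xᴴ bⱼ) + cⱼ`. -/
def constraint (j : Fin m) (x : Fin n → ℍ[ℝ]) : ℝ :=
  (star x ⬝ᵥ (P.A j *ᵥ x)).re + 2 * (star x ⬝ᵥ P.b j).re + P.c j

/-- The feasible set of the QCQP. -/
def feasible : Set (Fin n → ℍ[ℝ]) := {x | ∀ j, P.constraint j x ≤ 0}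

/-- The Slater condition. -/
def Slater : Prop := ∃ x₀ : Fin n → ℍ[ℝ], ∀ j, P.constraint j x₀ < 0

/-- The optimal value of the QCQP: the supremum of the objective over the feasible set. -/
def value : EReal := ⨆ x ∈ P.feasible, (P.objective x : EReal)

/-- `x` is an optimal solution of the QCQP. -/
def IsOptimal (x : Fin n → ℍ[ℝ]) : Prop :=
  x ∈ P.feasible ∧ IsMaxOn P.objective P.feasible x

/-- `B₀ = [0, qᴴ; q, Q]`. -/
def objectiveMatrix : Matrix (Unit ⊕ Fin n) (Unit ⊕ Fin n) ℍ[ℝ] :=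
  borderedMatrix 0 P.q P.Q

/-- `Bⱼ = [cⱼ, bⱼᴴ; bⱼ, Aⱼ]`, `j = 1, …, m`. -/
def constraintMatrix (j : Fin m) : Matrix (Unit ⊕ Fin n) (Unit ⊕ Fin n) ℍ[ℝ] :=
  borderedMatrix (P.c j) (P.b j) (P.A j)

/-- The feasible set of the SDP relaxation: `Bⱼ • X ≤ 0` for `j = 1, …, m`,
`[1, 0; 0, 0] • X = 1` and `X ⪰ 0`. -/
def relaxFeasible : Set (Matrix (Unit ⊕ Fin n) (Unit ⊕ Fin n) ℍ[ℝ]) :=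
  {X | (∀ j, quaternionInner (P.constraintMatrix j) X ≤ 0) ∧
    quaternionInner (borderedMatrix 1 0 0) X = 1 ∧ QuaternionPosSemidef X}

/-- The optimal value of the SDP relaxation: the supremum of `B₀ • X` over its feasible set. -/
def relaxValue : EReal :=
  ⨆ X ∈ P.relaxFeasible, (quaternionInner P.objectiveMatrix X : EReal)

/-- `X` is an optimal solution of the SDP relaxation. -/
def IsRelaxOptimal (X : Matrix (Unit ⊕ Fin n) (Unit ⊕ Fin n) ℍ[ℝ]) : Prop :=
  X ∈ P.relaxFeasible ∧ IsMaxOn (quaternionInner P.objectiveMatrix) P.relaxFeasible X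

end QuaternionQCQP

end

/-! A feasible `x` lifts to the rank-one matrix of `(1, x)`, so the relaxation can only be larger.
Conversely, split a feasible `X` into rank-one terms on each of which every constraint form is
nonpositive. A term with head `t ≠ 0` dehomogenizes to a feasible point, a term with `t = 0` is a
direction at infinity, and the `|t|²` sum to one. If `V` bounds the objective, each term contributes
at most `V |t|²` (`reForm_objectiveMatrix_le`), hence `B₀ • X ≤ V`. When `X` is optimal, equality
must hold in every term, which gives the optimal solutions.

The number four is the real dimension of `ℍ`. To equalize a fourth form without disturbing three
others, a quaternion phase must kill three real cross terms (`exists_rotation`). At infinity, a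
phase must make four cross terms nonpositive (`exists_ne_zero_nonpos`). -/

namespace QuaternionQCQP

/-! ### Hermitian forms on a right quaternion space. -/

variable {ι : Type*} [Fintype ι]

noncomputable section

/-- The real part `Re (uᴴ B v)` of the sesquilinear form of `B`. -/
def reForm (B : Matrix ι ι ℍ[ℝ]) (u v : ι → ℍ[ℝ]) : ℝ := (star u ⬝ᵥ (B *ᵥ v)).re

theorem re_mul_comm (a b : ℍ[ℝ]) : (a * b).re = (b * a).re := by
  simp only [Quaternion.re_mul]; ring

theorem re_sum {κ : Type*} (s : Finset κ) (f : κ → ℍ[ℝ]) :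
    (∑ i ∈ s, f i).re = ∑ i ∈ s, (f i).re :=
  map_sum (AddMonoidHom.mk' (fun a : ℍ[ℝ] => a.re) fun a b => Quaternion.re_add a b) f s

theorem reForm_add_left (B : Matrix ι ι ℍ[ℝ]) (u u' v : ι → ℍ[ℝ]) :
    reForm B (u + u') v = reForm B u v + reForm B u' v := by
  simp [reForm, add_dotProduct]

theorem reForm_add_right (B : Matrix ι ι ℍ[ℝ]) (u v v' : ι → ℍ[ℝ]) :
    reForm B u (v + v') = reForm B u v + reForm B u v' := by
  simp [reForm, Matrix.mulVec_add]

theorem reForm_smul_left (B : Matrix ι ι ℍ[ℝ]) (c : ℝ) (u v : ι → ℍ[ℝ]) :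
    reForm B (c • u) v = c * reForm B u v := by
  simp [reForm, dotProduct, Quaternion.star_smul, re_sum, Finset.mul_sum]

theorem reForm_smul_right (B : Matrix ι ι ℍ[ℝ]) (c : ℝ) (u v : ι → ℍ[ℝ]) :
    reForm B u (c • v) = c * reForm B u v := by
  simp [reForm, Matrix.mulVec_smul]

theorem star_form {B : Matrix ι ι ℍ[ℝ]} (hB : B.IsHermitian) (u v : ι → ℍ[ℝ]) :
    star (star u ⬝ᵥ (B *ᵥ v)) = star v ⬝ᵥ (B *ᵥ u) := by
  rw [← Matrix.star_dotProduct_star, star_star, Matrix.star_mulVec, hB.eq,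
    Matrix.dotProduct_mulVec]

theorem reForm_comm {B : Matrix ι ι ℍ[ℝ]} (hB : B.IsHermitian) (u v : ι → ℍ[ℝ]) :
    reForm B u v = reForm B v u := by
  rw [reForm, reForm, ← star_form hB, Quaternion.re_star]

/-- For Hermitian `B` the number `uᴴ B u` is real. -/
theorem form_eq_coe_reForm {B : Matrix ι ι ℍ[ℝ]} (hB : B.IsHermitian) (u : ι → ℍ[ℝ]) :
    star u ⬝ᵥ (B *ᵥ u) = ((reForm B u u : ℝ) : ℍ[ℝ]) :=
  Quaternion.star_eq_self.1 (star_form hB u u)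

theorem mulVec_op_smul (B : Matrix ι ι ℍ[ℝ]) (a : ℍ[ℝ]) (v : ι → ℍ[ℝ]) :
    B *ᵥ (MulOpposite.op a • v) = MulOpposite.op a • (B *ᵥ v) := by
  ext1 i
  simp [Matrix.mulVec, dotProduct, Finset.sum_mul, mul_assoc]

theorem form_op_smul_right (B : Matrix ι ι ℍ[ℝ]) (a : ℍ[ℝ]) (u v : ι → ℍ[ℝ]) :
    star u ⬝ᵥ (B *ᵥ (MulOpposite.op a • v)) = (star u ⬝ᵥ (B *ᵥ v)) * a := by
  rw [mulVec_op_smul]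
  simp [dotProduct, Finset.sum_mul, mul_assoc]

theorem form_op_smul_left (B : Matrix ι ι ℍ[ℝ]) (a : ℍ[ℝ]) (u v : ι → ℍ[ℝ]) :
    star (MulOpposite.op a • u) ⬝ᵥ (B *ᵥ v) = star a * (star u ⬝ᵥ (B *ᵥ v)) := by
  simp [dotProduct, Finset.mul_sum, mul_assoc]

/-- The value `uᴴ B u` is real, hence central, so `star a` and `a` meet and give `|a|²`. -/
theorem reForm_op_smul_self {B : Matrix ι ι ℍ[ℝ]} (hB : B.IsHermitian) (a : ℍ[ℝ])
    (u : ι → ℍ[ℝ]) :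
    reForm B (MulOpposite.op a • u) (MulOpposite.op a • u) = Quaternion.normSq a * reForm B u u := by
  rw [reForm, form_op_smul_left, form_op_smul_right, form_eq_coe_reForm hB, Quaternion.coe_commutes,
    ← mul_assoc, Quaternion.star_mul_self, ← Quaternion.coe_mul, Quaternion.re_coe]

theorem reForm_add_self {B : Matrix ι ι ℍ[ℝ]} (hB : B.IsHermitian) (u v : ι → ℍ[ℝ]) :
    reForm B (u + v) (u + v) = reForm B u u + reForm B v v + 2 * reForm B u v := by
  rw [reForm_add_left, reForm_add_right, reForm_add_right, reForm_comm hB v u]; ring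

theorem reForm_combination_self {B : Matrix ι ι ℍ[ℝ]} (hB : B.IsHermitian) (c s : ℝ)
    (u v : ι → ℍ[ℝ]) :
    reForm B (c • u + s • v) (c • u + s • v) =
      c ^ 2 * reForm B u u + s ^ 2 * reForm B v v + 2 * (c * s * reForm B u v) := by
  rw [reForm_add_self hB]
  simp only [reForm_smul_left, reForm_smul_right]; ring

theorem quaternionInner_vecMulVec {B : Matrix ι ι ℍ[ℝ]} (hB : B.IsHermitian) (v : ι → ℍ[ℝ]) :
    quaternionInner B (Matrix.vecMulVec v (star v)) = reForm B v v := by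
  rw [quaternionInner, hB.eq, Matrix.mul_vecMulVec, reForm]
  simp only [Matrix.trace, Matrix.diag, Matrix.vecMulVec_apply, dotProduct, re_sum]
  exact Finset.sum_congr rfl fun i _ => re_mul_comm _ _

theorem quaternionInner_sum {κ : Type*} [Fintype κ] {B : Matrix ι ι ℍ[ℝ]} (hB : B.IsHermitian)
    (v : κ → ι → ℍ[ℝ]) :
    quaternionInner B (∑ k, Matrix.vecMulVec (v k) (star (v k))) = ∑ k, reForm B (v k) (v k) := by
  simp only [← quaternionInner_vecMulVec hB]
  simp [quaternionInner, Matrix.mul_sum, Matrix.trace_sum, re_sum]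

/-! ### Real linear systems in one quaternion unknown. -/

/-- Four real linear inequalities on the quaternions have a nonzero solution. -/
theorem exists_ne_zero_nonpos (g : Fin 4 → ℍ[ℝ]) : ∃ a : ℍ[ℝ], a ≠ 0 ∧ ∀ j, (g j * a).re ≤ 0 := by
  let L : ℍ[ℝ] →ₗ[ℝ] (Fin 4 → ℝ) :=
    { toFun := fun a j => (g j * a).re
      map_add' := fun a b => by ext j; simp [mul_add]
      map_smul' := fun c a => by ext j; simp }
  -- Both sides have real dimension four: either `L` is onto and attains `-1` in every coordinate,
  -- or a kernel vector gives equalities.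
  by_cases hL : Function.Injective L
  · have hs : Function.Surjective L :=
      (LinearMap.injective_iff_surjective_of_finrank_eq_finrank (by simp [Quaternion.finrank_eq_four])).1 hL
    obtain ⟨a, ha⟩ := hs (fun _ => -1)
    refine ⟨a, ?_, fun j => ?_⟩
    · rintro rfl
      simpa using congrFun ha 0
    · have : (g j * a).re = -1 := congrFun ha j
      linarith
  · rw [← LinearMap.ker_eq_bot, Submodule.eq_bot_iff] at hL
    push Not at hL
    obtain ⟨a, ha, h0⟩ := hL
    exact ⟨a, h0, fun j => (congrFun (LinearMap.mem_ker.1 ha) j).le⟩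

/-- Three real linear equations on the quaternions have a solution of norm one. -/
theorem exists_normSq_eq_one_of_card_lt {κ : Type*} (s : Finset κ) (hs : s.card < 4)
    (g : κ → ℍ[ℝ]) :
    ∃ a : ℍ[ℝ], Quaternion.normSq a = 1 ∧ ∀ j ∈ s, (g j * a).re = 0 := by
  let L : ℍ[ℝ] →ₗ[ℝ] (s → ℝ) :=
    { toFun := fun a j => (g j * a).re
      map_add' := fun a b => by ext j; simp [mul_add]
      map_smul' := fun c a => by ext j; simp }
  have hk : LinearMap.ker L ≠ ⊥ := LinearMap.ker_ne_bot_of_finrank_lt (by simpa [Quaternion.finrank_eq_four] using hs)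
  obtain ⟨a, ha, h0⟩ := (Submodule.ne_bot_iff _).1 hk
  have hn : ‖a‖ ≠ 0 := norm_ne_zero_iff.2 h0
  refine ⟨‖a‖⁻¹ • a, ?_, fun j hj => ?_⟩
  · rw [Quaternion.normSq_eq_norm_mul_self, norm_smul, norm_inv, norm_norm, inv_mul_cancel₀ hn,
      one_mul]
  · have : (g j * a).re = 0 := congrFun (LinearMap.mem_ker.1 ha) ⟨j, hj⟩
    simp [this]

/-! ### Equalizing forms by rotating pairs of rank-one terms. -/

theorem vecMulVec_combination {σ : Type*} (c s : ℝ) (p q : σ → ℍ[ℝ]) (h : c ^ 2 + s ^ 2 = 1) :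
    Matrix.vecMulVec (c • p + s • q) (star (c • p + s • q)) +
      Matrix.vecMulVec ((-s) • p + c • q) (star ((-s) • p + c • q)) =
    Matrix.vecMulVec p (star p) + Matrix.vecMulVec q (star q) := by
  ext1 i j
  simp only [Matrix.add_apply, Matrix.vecMulVec_apply, Pi.add_apply, Pi.smul_apply, Pi.star_apply,
    star_add, Quaternion.star_smul, add_mul, mul_add, smul_mul_assoc, mul_smul_comm]
  have h1 : p i * star (p j) = (c ^ 2 + s ^ 2) • (p i * star (p j)) := by rw [h, one_smul]
  have h2 : q i * star (q j) = (c ^ 2 + s ^ 2) • (q i * star (q j)) := by rw [h, one_smul]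
  conv_rhs => rw [h1, h2]
  module

theorem vecMulVec_op_smul {σ : Type*} (a : ℍ[ℝ]) (ha : Quaternion.normSq a = 1) (q : σ → ℍ[ℝ]) :
    Matrix.vecMulVec (MulOpposite.op a • q) (star (MulOpposite.op a • q)) =
      Matrix.vecMulVec q (star q) := by
  ext1 i j
  simp only [Matrix.vecMulVec_apply, Pi.smul_apply, Pi.star_apply, MulOpposite.smul_eq_mul_unop,
    MulOpposite.unop_op, star_mul]
  rw [mul_assoc, ← mul_assoc a, Quaternion.self_mul_star, ha, Quaternion.coe_one, one_mul]

/-- Two rank-one terms on which up to three forms agree can be rotated, preserving their sum and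
these values, so that a further form takes a prescribed intermediate value on one of them. -/
theorem exists_rotation {κ : Type*} {B : κ → Matrix ι ι ℍ[ℝ]} (hB : ∀ j, (B j).IsHermitian)
    (s : Finset κ) (hs : s.card < 4) (d : κ → ℝ) (j₀ : κ) (p q : ι → ℍ[ℝ])
    (hp : ∀ j ∈ s, reForm (B j) p p = d j) (hq : ∀ j ∈ s, reForm (B j) q q = d j)
    (hp₀ : reForm (B j₀) p p < d j₀) (hq₀ : d j₀ < reForm (B j₀) q q) :
    ∃ w w' : ι → ℍ[ℝ],
      Matrix.vecMulVec w (star w) + Matrix.vecMulVec w' (star w') =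
        Matrix.vecMulVec p (star p) + Matrix.vecMulVec q (star q) ∧
      (∀ j ∈ s, reForm (B j) w w = d j) ∧ (∀ j ∈ s, reForm (B j) w' w' = d j) ∧
      reForm (B j₀) w w = d j₀ := by
  -- A unit phase leaves `q qᴴ` unchanged and is chosen to kill the cross terms in `s`; every real
  -- rotation of `p` and `q'` then keeps the values `d j`.
  obtain ⟨a, ha, hga⟩ := exists_normSq_eq_one_of_card_lt s hs fun j => star p ⬝ᵥ (B j *ᵥ q)
  set q' := MulOpposite.op a • q with hq'
  have hqq (j : κ) : reForm (B j) q' q' = reForm (B j) q q := by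
    rw [hq', reForm_op_smul_self (hB j), ha, one_mul]
  have hpq (j : κ) (hj : j ∈ s) : reForm (B j) p q' = 0 := by
    rw [reForm, hq', form_op_smul_right, hga j hj]
  -- The form `B j₀` on the rotated vector: it runs from its value at `p` to its value at `q`, so it
  -- passes through `d j₀`.
  let f : ℝ → ℝ := fun θ => Real.cos θ ^ 2 * reForm (B j₀) p p +
    Real.sin θ ^ 2 * reForm (B j₀) q' q' + 2 * (Real.cos θ * Real.sin θ * reForm (B j₀) p q')
  have hf : Continuous f := by fun_prop
  obtain ⟨θ, -, hθ⟩ : d j₀ ∈ f '' Set.Icc 0 (Real.pi / 2) := by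
    refine intermediate_value_Icc (by positivity) hf.continuousOn ⟨?_, ?_⟩
    · simpa [f] using hp₀.le
    · simpa [f, hqq] using hq₀.le
  have h1 : Real.cos θ ^ 2 + Real.sin θ ^ 2 = 1 := Real.cos_sq_add_sin_sq θ
  refine ⟨Real.cos θ • p + Real.sin θ • q', (-Real.sin θ) • p + Real.cos θ • q', ?_, ?_, ?_, ?_⟩
  · rw [vecMulVec_combination _ _ _ _ h1, hq', vecMulVec_op_smul a ha]
  · intro j hj
    rw [reForm_combination_self (hB j), hpq j hj, hqq, hp j hj, hq j hj]
    linear_combination d j * h1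
  · intro j hj
    rw [reForm_combination_self (hB j), hpq j hj, hqq, hp j hj, hq j hj]
    linear_combination d j * h1
  · rw [reForm_combination_self (hB j₀)]
    exact hθ

/-- One more form can be made constant on the terms of a rank-one decomposition. -/
theorem exists_equalize_insert {κ : Type*} [DecidableEq κ] {r : ℕ} {B : κ → Matrix ι ι ℍ[ℝ]}
    (hB : ∀ j, (B j).IsHermitian) (s : Finset κ) (hs : s.card < 4) (d : κ → ℝ) (j₀ : κ)
    {X : Matrix ι ι ℍ[ℝ]} (hd : quaternionInner (B j₀) X = r * d j₀) (N : ℕ) :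
    ∀ v : Fin r → ι → ℍ[ℝ], X = ∑ k, Matrix.vecMulVec (v k) (star (v k)) →
      (∀ j ∈ s, ∀ k, reForm (B j) (v k) (v k) = d j) →
      (Finset.univ.filter fun k => reForm (B j₀) (v k) (v k) ≠ d j₀).card = N →
      ∃ v : Fin r → ι → ℍ[ℝ], X = ∑ k, Matrix.vecMulVec (v k) (star (v k)) ∧
        ∀ j ∈ insert j₀ s, ∀ k, reForm (B j) (v k) (v k) = d j := by
  -- `N` counts the terms whose value is not yet `d j₀`; each rotation lowers it.
  induction N using Nat.strong_induction_on with
  | _ N ih =>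
  intro v hv hvs hN
  by_cases hall : ∀ k, reForm (B j₀) (v k) (v k) = d j₀
  · refine ⟨v, hv, fun j hj k => ?_⟩
    rcases Finset.mem_insert.1 hj with rfl | hj
    exacts [hall k, hvs j hj k]
  have hsum : ∑ k, reForm (B j₀) (v k) (v k) = ∑ _k : Fin r, d j₀ := by
    rw [← quaternionInner_sum (hB j₀), ← hv, hd]; simp
  push Not at hall
  -- The mean of the values is `d j₀`, so a deviation on one side forces one on the other.
  obtain ⟨k, l, hk, hl⟩ : ∃ k l, reForm (B j₀) (v k) (v k) < d j₀ ∧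
      d j₀ < reForm (B j₀) (v l) (v l) := by
    obtain ⟨i, hi⟩ := hall
    by_contra! hcon
    rcases lt_or_gt_of_ne hi with hlt | hgt
    · exact (Finset.sum_lt_sum (fun l _ => hcon i l hlt) ⟨i, Finset.mem_univ _, hlt⟩).ne hsum
    · refine (Finset.sum_lt_sum (fun l _ => ?_) ⟨i, Finset.mem_univ _, hgt⟩).ne' hsum
      by_contra! hlt
      exact (hcon l i hlt).not_gt hgt
  have hkl : k ≠ l := by rintro rfl; exact hk.not_gt hl
  obtain ⟨w, w', hww, hw, hw', hw₀⟩ := exists_rotation hB s hs d j₀ (v k) (v l)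
    (fun j hj => hvs j hj k) (fun j hj => hvs j hj l) hk hl
  let v' := Function.update (Function.update v k w) l w'
  have hv'l : v' l = w' := by simp [v']
  have hv'k : v' k = w := by simp [v', hkl]
  have hv'o (i) (hik : i ≠ k) (hil : i ≠ l) : v' i = v i := by simp [v', hik, hil]
  refine ih _ ?_ v' ?_ ?_ rfl
  · rw [← hN]
    -- Both `k` and `l` were exceptional and `k` no longer is, so the new value at `l` does not
    -- matter.
    refine Finset.card_lt_card ((Finset.ssubset_iff_of_subset fun i hi => ?_).2 ⟨k, ?_, ?_⟩)
    · simp only [Finset.mem_filter, Finset.mem_univ, true_and] at hi ⊢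
      by_cases hik : i = k
      · exact hik ▸ hk.ne
      by_cases hil : i = l
      · exact hil ▸ hl.ne'
      rwa [hv'o i hik hil] at hi
    · simpa using hk.ne
    · simp [hv'k, hw₀]
  · have split (u : Fin r → ι → ℍ[ℝ]) : ∑ i, Matrix.vecMulVec (u i) (star (u i)) =
        (Matrix.vecMulVec (u k) (star (u k)) + Matrix.vecMulVec (u l) (star (u l))) +
          ∑ i ∈ (Finset.univ.erase k).erase l, Matrix.vecMulVec (u i) (star (u i)) := by
      rw [add_assoc, Finset.add_sum_erase _ (fun i => Matrix.vecMulVec (u i) (star (u i)))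
        (by simp [hkl.symm]),
        Finset.add_sum_erase _ (fun i => Matrix.vecMulVec (u i) (star (u i))) (Finset.mem_univ k)]
    rw [hv, split v, split v', hv'k, hv'l, hww]
    congr 1
    refine Finset.sum_congr rfl fun i hi => ?_
    simp only [Finset.mem_erase, Finset.mem_univ, and_true] at hi
    rw [hv'o i hi.2 hi.1]
  · intro j hj i
    by_cases hik : i = k
    · rw [hik, hv'k, hw j hj]
    by_cases hil : i = l
    · rw [hil, hv'l, hw' j hj]
    rw [hv'o i hik hil, hvs j hj i]

theorem exists_equalize {κ : Type*} {r : ℕ} {B : κ → Matrix ι ι ℍ[ℝ]}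
    (hB : ∀ j, (B j).IsHermitian) (d : κ → ℝ) {X : Matrix ι ι ℍ[ℝ]}
    (hd : ∀ j, quaternionInner (B j) X = r * d j) (v : Fin r → ι → ℍ[ℝ])
    (hv : X = ∑ k, Matrix.vecMulVec (v k) (star (v k))) (s : Finset κ) (hs : s.card ≤ 4) :
    ∃ v : Fin r → ι → ℍ[ℝ], X = ∑ k, Matrix.vecMulVec (v k) (star (v k)) ∧
      ∀ j ∈ s, ∀ k, reForm (B j) (v k) (v k) = d j := by
  classical
  induction s using Finset.induction_on with
  | empty => exact ⟨v, hv, by simp⟩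
  | insert j₀ s hj₀ ih =>
    rw [Finset.card_insert_of_notMem hj₀] at hs
    obtain ⟨u, hu, hus⟩ := ih (by omega)
    exact exists_equalize_insert hB s (by omega) d j₀ (hd j₀) _ u hu hus rfl

/-! ### Column space, rank and rank-one factorization. -/

instance finite_quaternion_mulOpposite : Module.Finite ℍ[ℝ]ᵐᵒᵖ ℍ[ℝ] :=
  ⟨⟨{1}, by
    rw [Finset.coe_singleton, Submodule.eq_top_iff']
    exact fun a => Submodule.mem_span_singleton.2 ⟨MulOpposite.op a, by simp⟩⟩⟩

/-- The column space of a quaternion matrix consists of the vectors `X y`. -/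
theorem mem_columnSpace {X : Matrix ι ι ℍ[ℝ]} {w : ι → ℍ[ℝ]} :
    w ∈ Submodule.span ℍ[ℝ]ᵐᵒᵖ (Set.range Xᵀ) ↔ ∃ y, X *ᵥ y = w := by
  refine (Submodule.mem_span_range_iff_exists_fun _).trans ⟨?_, ?_⟩
  · rintro ⟨c, rfl⟩
    refine ⟨fun i => (c i).unop, ?_⟩
    ext1 i
    simp [Matrix.mulVec, dotProduct, Finset.sum_apply]
  · rintro ⟨y, rfl⟩
    refine ⟨fun i => MulOpposite.op (y i), ?_⟩
    ext1 i
    simp [Matrix.mulVec, dotProduct, Finset.sum_apply]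

theorem vecMulVec_mulVec_star (w y : ι → ℍ[ℝ]) :
    Matrix.vecMulVec w (star w) *ᵥ y = MulOpposite.op (star w ⬝ᵥ y) • w := by
  ext1 i
  simp [Matrix.mulVec, dotProduct, Matrix.vecMulVec_apply, Finset.mul_sum, mul_assoc]

/-- Polarization gives `Re (uᴴ X v) = 0`; taking `u = X v` leaves a vanishing sum of squared norms.
-/
theorem eq_zero_of_reForm_self_eq_zero {X : Matrix ι ι ℍ[ℝ]} (hX : X.IsHermitian)
    (h : ∀ u, reForm X u u = 0) : X = 0 := by
  classical
  have h2 (u v) : reForm X u v = 0 := by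
    have := reForm_add_self hX u v
    rw [h, h, h] at this
    linarith
  have h3 (v) : X *ᵥ v = 0 := by
    have h4 := h2 (X *ᵥ v) v
    rw [reForm, dotProduct, re_sum, Finset.sum_eq_zero_iff_of_nonneg] at h4
    · ext1 i
      have := h4 i (Finset.mem_univ i)
      rwa [Pi.star_apply, Quaternion.star_mul_self, Quaternion.re_coe, Quaternion.normSq_eq_zero]
        at this
    · intro i _
      rw [Pi.star_apply, Quaternion.star_mul_self, Quaternion.re_coe]
      exact Quaternion.normSq_nonneg
  ext1 i j
  simpa using congrFun (h3 (Pi.single j 1)) i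

/-- Deflation: subtracting `w wᴴ` with `w = X u / √(uᴴ X u)` keeps `X` positive semidefinite and
lowers its rank by one. -/
theorem exists_deflation {X : Matrix ι ι ℍ[ℝ]} (hX : QuaternionPosSemidef X) (h0 : X ≠ 0) :
    ∃ w : ι → ℍ[ℝ], QuaternionPosSemidef (X - Matrix.vecMulVec w (star w)) ∧
      quaternionRank X = quaternionRank (X - Matrix.vecMulVec w (star w)) + 1 := by
  obtain ⟨hXh, hXp⟩ := hX
  obtain ⟨u, hu⟩ : ∃ u, reForm X u u ≠ 0 := by
    by_contra! hcon
    exact h0 (eq_zero_of_reForm_self_eq_zero hXh hcon)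
  have hu : 0 < reForm X u u := lt_of_le_of_ne (hXp u) hu.symm
  set σ := reForm X u u with hσ
  set ρ := (√σ)⁻¹ with hρ
  have hρ0 : ρ ≠ 0 := inv_ne_zero (Real.sqrt_pos.2 hu).ne'
  have hρσ : ρ * ρ * σ = 1 := by
    rw [hρ, ← mul_inv, Real.mul_self_sqrt hu.le, inv_mul_cancel₀ hu.ne']
  let w : ι → ℍ[ℝ] := ρ • (X *ᵥ u)
  have hwy (y : ι → ℍ[ℝ]) : star w ⬝ᵥ y = ρ • (star u ⬝ᵥ (X *ᵥ y)) := by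
    have h1 : star u ⬝ᵥ (X *ᵥ y) = star (X *ᵥ u) ⬝ᵥ y := by
      rw [Matrix.star_mulVec, hXh.eq, Matrix.dotProduct_mulVec]
    rw [h1]
    simp [w, dotProduct, Quaternion.star_smul, Finset.smul_sum]
  have hyw (y : ι → ℍ[ℝ]) : star y ⬝ᵥ w = ρ • (star y ⬝ᵥ (X *ᵥ u)) := by
    simp [w, dotProduct, Finset.smul_sum]
  set X' := X - Matrix.vecMulVec w (star w) with hX'
  have hX'y (y : ι → ℍ[ℝ]) : X' *ᵥ y = X *ᵥ y - MulOpposite.op (star w ⬝ᵥ y) • w := by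
    rw [hX', Matrix.sub_mulVec, vecMulVec_mulVec_star]
  have hX'h : X'.IsHermitian := by
    refine hXh.sub ?_
    ext1 i j
    simp [Matrix.vecMulVec_apply]
  -- The scaling `ρ² σ = 1` is exactly what puts `u` in the kernel of `X'`.
  have hX'u : X' *ᵥ u = 0 := by
    rw [hX'y, hwy, form_eq_coe_reForm hXh, ← hσ]
    ext1 i
    have h1 : (X *ᵥ u) i = (ρ * ρ * σ) • (X *ᵥ u) i := by rw [hρσ, one_smul]
    simp only [Pi.sub_apply, Pi.smul_apply, MulOpposite.smul_eq_mul_unop, MulOpposite.unop_op, w,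
      Pi.zero_apply, mul_smul_comm, smul_mul_assoc, smul_smul, Quaternion.mul_coe_eq_smul]
    conv_lhs => enter [1]; rw [h1]
    module
  refine ⟨w, ⟨hX'h, fun y => ?_⟩, ?_⟩
  · set β := star u ⬝ᵥ (X *ᵥ y) with hβ
    have hform : (star y ⬝ᵥ (X' *ᵥ y)).re = reForm X y y - σ⁻¹ * Quaternion.normSq β := by
      have h1 : star y ⬝ᵥ (MulOpposite.op (star w ⬝ᵥ y) • w) = (star y ⬝ᵥ w) * (star w ⬝ᵥ y) := by
        simp [dotProduct, Finset.sum_mul, mul_assoc]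
      rw [hX'y, dotProduct_sub, h1, hyw, hwy, ← star_form hXh u y, ← hβ, smul_mul_smul_comm,
        Quaternion.star_mul_self, Quaternion.re_sub, Quaternion.re_smul, Quaternion.re_coe,
        eq_inv_of_mul_eq_one_left hρσ, reForm, smul_eq_mul]
    rw [hform]
    -- Cauchy–Schwarz for `X`: this multiple of `u` minimizes the form on `y + u a`, and the minimum
    -- is the form of `X'` at `y`.
    have h2 := hXp (y + MulOpposite.op (-(σ⁻¹ • β)) • u)
    change 0 ≤ reForm X _ _ at h2
    have h3 : reForm X y (MulOpposite.op (-(σ⁻¹ • β)) • u) = -(σ⁻¹ * Quaternion.normSq β) := by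
      rw [reForm, form_op_smul_right, ← star_form hXh u y, ← hβ, mul_neg, mul_smul_comm,
        Quaternion.star_mul_self, Quaternion.re_neg, Quaternion.re_smul, Quaternion.re_coe,
        smul_eq_mul]
    rw [reForm_add_self hXh, reForm_op_smul_self hXh, h3, Quaternion.normSq_neg,
      Quaternion.normSq_smul, ← hσ] at h2
    have h4 : σ⁻¹ ^ 2 * Quaternion.normSq β * σ = σ⁻¹ * Quaternion.normSq β := by
      field_simp
    linarith
  -- As `X'` is Hermitian and kills `u`, its column space is orthogonal to `u`, whereas `uᴴ w = ρ σ
  -- ≠ 0`.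
  · have hw : w ∉ Submodule.span ℍ[ℝ]ᵐᵒᵖ (Set.range X'ᵀ) := by
      rw [mem_columnSpace]
      rintro ⟨y, hy⟩
      have h1 := hyw u
      rw [← hy, ← star_form hX'h y u, hX'u, dotProduct_zero, star_zero, form_eq_coe_reForm hXh,
        ← hσ] at h1
      have h2 := congrArg (fun a : ℍ[ℝ] => a.re) h1
      simp only [Quaternion.re_zero, Quaternion.re_smul, Quaternion.re_coe, smul_eq_mul] at h2
      exact mul_ne_zero hρ0 hu.ne' h2.symm
    have hspan : Submodule.span ℍ[ℝ]ᵐᵒᵖ (Set.range Xᵀ) =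
        Submodule.span ℍ[ℝ]ᵐᵒᵖ (Set.range X'ᵀ) ⊔ Submodule.span ℍ[ℝ]ᵐᵒᵖ {w} := by
      have hwX : w ∈ Submodule.span ℍ[ℝ]ᵐᵒᵖ (Set.range Xᵀ) :=
        mem_columnSpace.2 ⟨ρ • u, by rw [Matrix.mulVec_smul]⟩
      apply le_antisymm
      · intro z hz
        obtain ⟨y, rfl⟩ := mem_columnSpace.1 hz
        refine Submodule.mem_sup.2 ⟨X' *ᵥ y, mem_columnSpace.2 ⟨y, rfl⟩, _,
          Submodule.mem_span_singleton.2 ⟨MulOpposite.op (star w ⬝ᵥ y), rfl⟩, ?_⟩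
        rw [hX'y, sub_add_cancel]
      · refine sup_le (fun z hz => ?_) ((Submodule.span_singleton_le_iff_mem _ _).2 hwX)
        obtain ⟨y, rfl⟩ := mem_columnSpace.1 hz
        rw [hX'y]
        exact Submodule.sub_mem _ (mem_columnSpace.2 ⟨y, rfl⟩) (Submodule.smul_mem _ _ hwX)
    rw [quaternionRank, quaternionRank, hspan, Submodule.finrank_sup_span_singleton hw]

/-- A positive semidefinite quaternion matrix of rank `r` is a sum of `r` rank-one terms. -/
theorem exists_sum_vecMulVec (r : ℕ) : ∀ {X : Matrix ι ι ℍ[ℝ]}, QuaternionPosSemidef X →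
    quaternionRank X = r →
    ∃ v : Fin r → ι → ℍ[ℝ], X = ∑ k, Matrix.vecMulVec (v k) (star (v k)) := by
  induction r with
  | zero =>
    intro X _ hr
    refine ⟨fun _ => 0, ?_⟩
    have h0 : Submodule.span ℍ[ℝ]ᵐᵒᵖ (Set.range Xᵀ) = ⊥ := Submodule.finrank_eq_zero.1 hr
    rw [Submodule.span_eq_bot] at h0
    ext1 i j
    simpa using congrFun (h0 (Xᵀ j) ⟨j, rfl⟩) i
  | succ r ih =>
    intro X hX hr
    have h0 : X ≠ 0 := by
      rintro rfl
      have h1 : Submodule.span ℍ[ℝ]ᵐᵒᵖ (Set.range (0 : Matrix ι ι ℍ[ℝ])ᵀ) = ⊥ := by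
        rw [Submodule.span_eq_bot]
        rintro _ ⟨j, rfl⟩
        rfl
      rw [quaternionRank, h1, finrank_bot] at hr
      omega
    obtain ⟨w, hw, hwr⟩ := exists_deflation hX h0
    obtain ⟨v, hv⟩ := ih hw (by omega)
    refine ⟨Fin.cons w v, ?_⟩
    rw [Fin.sum_univ_succ]
    simp only [Fin.cons_zero, Fin.cons_succ]
    rw [← hv, add_sub_cancel]

/-- Four Hermitian forms can be made constant on a rank-one decomposition. -/
theorem exists_isRankOneDecomposition {m : ℕ} (hm : m ≤ 4) {B : Fin m → Matrix ι ι ℍ[ℝ]}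
    (hB : ∀ j, (B j).IsHermitian) {X : Matrix ι ι ℍ[ℝ]} (hX : QuaternionPosSemidef X) :
    ∃ v, IsRankOneDecomposition B X v := by
  obtain ⟨v, hv⟩ := exists_sum_vecMulVec _ hX rfl
  have hd (j : Fin m) : quaternionInner (B j) X =
      quaternionRank X * (quaternionInner (B j) X / quaternionRank X) := by
    -- In rank zero the quotient is the default `0`, and the inner product is an empty sum.
    by_cases h0 : quaternionRank X = 0
    · have hF : IsEmpty (Fin (quaternionRank X)) := by rw [h0]; infer_instance
      have : quaternionInner (B j) X = 0 := by
        conv_lhs => rw [hv, quaternionInner_sum (hB j)]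
        exact Finset.sum_of_isEmpty _
      simp [this]
    · rw [mul_div_cancel₀ _ (Nat.cast_ne_zero.2 h0)]
  obtain ⟨u, hu, hus⟩ := exists_equalize hB _ hd v hv Finset.univ (by simpa using hm)
  exact ⟨u, hu, fun j k => by rw [form_eq_coe_reForm (hB j), hus j (Finset.mem_univ j) k]⟩

end

end QuaternionQCQP

/-! ### Homogenization and lifting to the relaxation. -/

namespace QuaternionQCQP

noncomputable section

theorem isHermitian_borderedMatrix {n : ℕ} (c : ℝ) (b : Fin n → ℍ[ℝ])
    {A : Matrix (Fin n) (Fin n) ℍ[ℝ]} (hA : A.IsHermitian) :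
    (borderedMatrix c b A).IsHermitian := by
  refine Matrix.IsHermitian.fromBlocks ?_ ?_ hA
  · ext1 i j
    simp
  · ext1 i j
    simp

theorem reForm_borderedMatrix {n : ℕ} (c : ℝ) (b : Fin n → ℍ[ℝ]) (A : Matrix (Fin n) (Fin n) ℍ[ℝ])
    {z : Unit ⊕ Fin n → ℍ[ℝ]} (hz : z (Sum.inl ()) = 1) :
    reForm (borderedMatrix c b A) z z = (star (z ∘ Sum.inr) ⬝ᵥ (A *ᵥ (z ∘ Sum.inr))).re +
      2 * (star (z ∘ Sum.inr) ⬝ᵥ b).re + c := by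
  have h1 : (star b ⬝ᵥ (z ∘ Sum.inr)).re = (star (z ∘ Sum.inr) ⬝ᵥ b).re := by
    rw [← Quaternion.re_star, ← Matrix.star_dotProduct_star, star_star]
  have h2 : reForm (borderedMatrix c b A) z z = c + (star b ⬝ᵥ (z ∘ Sum.inr)).re +
      ((star (z ∘ Sum.inr) ⬝ᵥ b).re + (star (z ∘ Sum.inr) ⬝ᵥ (A *ᵥ (z ∘ Sum.inr))).re) := by
    simp [reForm, borderedMatrix, dotProduct, Matrix.mulVec, hz, mul_add, Finset.sum_add_distrib]
    ring
  rw [h2, h1]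
  ring

theorem reForm_borderedMatrix_one {n : ℕ} (z : Unit ⊕ Fin n → ℍ[ℝ]) :
    reForm (borderedMatrix 1 0 0) z z = Quaternion.normSq (z (Sum.inl ())) := by
  simp [reForm, borderedMatrix, dotProduct, Matrix.mulVec, Quaternion.star_mul_self]

theorem quaternionPosSemidef_vecMulVec {ι : Type*} [Fintype ι] (z : ι → ℍ[ℝ]) :
    QuaternionPosSemidef (Matrix.vecMulVec z (star z)) := by
  refine ⟨?_, fun u => ?_⟩
  · ext1 i j
    simp [Matrix.vecMulVec_apply]
  · have h1 : star u ⬝ᵥ (MulOpposite.op (star z ⬝ᵥ u) • z) = (star u ⬝ᵥ z) * (star z ⬝ᵥ u) := by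
      simp [dotProduct, Finset.sum_mul, mul_assoc]
    rw [vecMulVec_mulVec_star, h1, ← star_star z, Matrix.star_dotProduct_star, star_star,
      Quaternion.star_mul_self, Quaternion.re_coe]
    exact Quaternion.normSq_nonneg

variable {n m : ℕ} (P : QuaternionQCQP n m)

theorem isHermitian_objectiveMatrix : P.objectiveMatrix.IsHermitian :=
  isHermitian_borderedMatrix _ _ P.Q_hermitian

theorem isHermitian_constraintMatrix (j : Fin m) : (P.constraintMatrix j).IsHermitian :=
  isHermitian_borderedMatrix _ _ (P.A_hermitian j)

theorem reForm_objectiveMatrix {z : Unit ⊕ Fin n → ℍ[ℝ]} (hz : z (Sum.inl ()) = 1) :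
    reForm P.objectiveMatrix z z = P.objective (z ∘ Sum.inr) := by
  rw [objectiveMatrix, reForm_borderedMatrix _ _ _ hz, add_zero, objective]

theorem reForm_constraintMatrix (j : Fin m) {z : Unit ⊕ Fin n → ℍ[ℝ]} (hz : z (Sum.inl ()) = 1) :
    reForm (P.constraintMatrix j) z z = P.constraint j (z ∘ Sum.inr) := by
  rw [constraintMatrix, reForm_borderedMatrix _ _ _ hz, constraint]

/-- Every feasible point of the QCQP gives a feasible point of the relaxation with the same
objective. -/
theorem exists_relaxFeasible {x : Fin n → ℍ[ℝ]} (hx : x ∈ P.feasible) :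
    ∃ X ∈ P.relaxFeasible, quaternionInner P.objectiveMatrix X = P.objective x := by
  let z : Unit ⊕ Fin n → ℍ[ℝ] := Sum.elim (fun _ => 1) x
  have hz : z (Sum.inl ()) = 1 := rfl
  refine ⟨Matrix.vecMulVec z (star z), ⟨fun j => ?_, ?_, quaternionPosSemidef_vecMulVec z⟩, ?_⟩
  · rw [quaternionInner_vecMulVec (P.isHermitian_constraintMatrix j),
      P.reForm_constraintMatrix j hz]
    exact hx j
  · rw [quaternionInner_vecMulVec (isHermitian_borderedMatrix _ _ Matrix.isHermitian_zero),
      reForm_borderedMatrix_one, hz, map_one]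
  · rw [quaternionInner_vecMulVec P.isHermitian_objectiveMatrix, P.reForm_objectiveMatrix hz]
    rfl

theorem op_inv_smul_inl {v : Unit ⊕ Fin n → ℍ[ℝ]} (hv : v (Sum.inl ()) ≠ 0) :
    (MulOpposite.op (v (Sum.inl ()))⁻¹ • v) (Sum.inl ()) = 1 := by
  simp [hv]

/-- Right multiplication by `t⁻¹` makes the head one and scales the form by `|t|⁻²`. -/
theorem constraint_dehomogenize (j : Fin m) {v : Unit ⊕ Fin n → ℍ[ℝ]}
    (hv : v (Sum.inl ()) ≠ 0) :
    P.constraint j (dehomogenize v) =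
      (Quaternion.normSq (v (Sum.inl ())))⁻¹ * reForm (P.constraintMatrix j) v v := by
  rw [← Quaternion.normSq_inv, ← reForm_op_smul_self (P.isHermitian_constraintMatrix j),
    P.reForm_constraintMatrix j (op_inv_smul_inl hv)]
  rfl

theorem objective_dehomogenize {v : Unit ⊕ Fin n → ℍ[ℝ]} (hv : v (Sum.inl ()) ≠ 0) :
    P.objective (dehomogenize v) =
      (Quaternion.normSq (v (Sum.inl ())))⁻¹ * reForm P.objectiveMatrix v v := by
  rw [← Quaternion.normSq_inv, ← reForm_op_smul_self P.isHermitian_objectiveMatrix,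
    P.reForm_objectiveMatrix (op_inv_smul_inl hv)]
  rfl

theorem dehomogenize_mem_feasible {v : Unit ⊕ Fin n → ℍ[ℝ]} (hv : v (Sum.inl ()) ≠ 0)
    (hB : ∀ j, reForm (P.constraintMatrix j) v v ≤ 0) : dehomogenize v ∈ P.feasible := fun j => by
  rw [P.constraint_dehomogenize j hv]
  exact mul_nonpos_of_nonneg_of_nonpos (inv_nonneg.2 Quaternion.normSq_nonneg) (hB j)

/-! ### Bounds, equality of values and optimality. -/

/-- An upper bound for the objective on a nonempty feasible set bounds the homogenized objective on
all vectors satisfying the four homogenized constraints, including those at infinity. -/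
theorem reForm_objectiveMatrix_le (P : QuaternionQCQP n 4) {x₀ : Fin n → ℍ[ℝ]}
    (hx₀ : x₀ ∈ P.feasible) {V : ℝ} (hV : ∀ x ∈ P.feasible, P.objective x ≤ V)
    {v : Unit ⊕ Fin n → ℍ[ℝ]} (hB : ∀ j, reForm (P.constraintMatrix j) v v ≤ 0) :
    reForm P.objectiveMatrix v v ≤ V * Quaternion.normSq (v (Sum.inl ())) := by
  by_cases hv : v (Sum.inl ()) = 0
  · rw [hv, map_zero, mul_zero]
    by_contra! hpos
    let z₀ : Unit ⊕ Fin n → ℍ[ℝ] := Sum.elim (fun _ => 1) x₀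
    have hz₀ : z₀ (Sum.inl ()) = 1 := rfl
    -- With nonpositive cross terms the whole ray `z₀ + s • y`, `s ≥ 0`, is feasible, and the
    -- objective grows quadratically along it.
    obtain ⟨a, ha, hga⟩ := exists_ne_zero_nonpos fun j => star z₀ ⬝ᵥ (P.constraintMatrix j *ᵥ v)
    set y := MulOpposite.op a • v with hy
    have hs1 (s : ℝ) : (z₀ + s • y) (Sum.inl ()) = 1 := by simp [hz₀, hy, hv]
    have hexp {B : Matrix (Unit ⊕ Fin n) (Unit ⊕ Fin n) ℍ[ℝ]} (hBh : B.IsHermitian) (s : ℝ) :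
        reForm B (z₀ + s • y) (z₀ + s • y) = reForm B z₀ z₀ +
          s ^ 2 * (Quaternion.normSq a * reForm B v v) + 2 * (s * reForm B z₀ y) := by
      have := reForm_combination_self hBh 1 s z₀ y
      rw [one_smul] at this
      rw [this, hy, reForm_op_smul_self hBh]
      ring
    have hfeas (s : ℝ) (hs : 0 ≤ s) : (z₀ + s • y) ∘ Sum.inr ∈ P.feasible := fun j => by
      rw [← P.reForm_constraintMatrix j (hs1 s), hexp (P.isHermitian_constraintMatrix j)]
      have h1 : reForm (P.constraintMatrix j) z₀ z₀ ≤ 0 := by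
        rw [P.reForm_constraintMatrix j hz₀]
        exact hx₀ j
      have h2 : reForm (P.constraintMatrix j) z₀ y ≤ 0 := by
        rw [reForm, hy, form_op_smul_right]
        exact hga j
      have h3 : s ^ 2 * (Quaternion.normSq a * reForm (P.constraintMatrix j) v v) ≤ 0 :=
        mul_nonpos_of_nonneg_of_nonpos (sq_nonneg s)
          (mul_nonpos_of_nonneg_of_nonpos Quaternion.normSq_nonneg (hB j))
      have h4 := mul_nonpos_of_nonneg_of_nonpos hs h2
      linarith
    set α := Quaternion.normSq a * reForm P.objectiveMatrix v v with hα
    set γ := reForm P.objectiveMatrix z₀ y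
    set o := reForm P.objectiveMatrix z₀ z₀
    have hα0 : 0 < α := mul_pos
      (lt_of_le_of_ne Quaternion.normSq_nonneg (Quaternion.normSq_ne_zero.2 ha).symm) hpos
    -- Chosen so that `s ≥ 1` and `s α + 2γ ≥ α + |V - o|`; the objective at `s` then exceeds `V`.
    set s := 1 + (|V - o| + 2 * |γ|) / α with hs
    have hs0 : 1 ≤ s := by
      have : 0 ≤ (|V - o| + 2 * |γ|) / α := by positivity
      linarith
    have hsα : s * α = α + |V - o| + 2 * |γ| := by
      rw [hs]
      field_simp
      ring
    have h1 := hV _ (hfeas s (by linarith))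
    rw [← P.reForm_objectiveMatrix (hs1 s), hexp P.isHermitian_objectiveMatrix] at h1
    have h2 : α + |V - o| ≤ s * α + 2 * γ := by
      have := neg_abs_le γ
      linarith
    have h3 : s * α + 2 * γ ≤ s * (s * α + 2 * γ) :=
      le_mul_of_one_le_left (le_trans (by positivity) h2) hs0
    have h4 := le_abs_self (V - o)
    nlinarith
  · have h1 := hV _ (P.dehomogenize_mem_feasible hv hB)
    have h2 : 0 < Quaternion.normSq (v (Sum.inl ())) :=
      lt_of_le_of_ne Quaternion.normSq_nonneg (Quaternion.normSq_ne_zero.2 hv).symm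
    rwa [P.objective_dehomogenize hv, inv_mul_le_iff₀ h2, mul_comm] at h1

theorem reForm_nonpos_of_isRankOneDecomposition
    {X : Matrix (Unit ⊕ Fin n) (Unit ⊕ Fin n) ℍ[ℝ]} (hX : X ∈ P.relaxFeasible)
    {v : Fin (quaternionRank X) → Unit ⊕ Fin n → ℍ[ℝ]}
    (hv : IsRankOneDecomposition P.constraintMatrix X v) (k : Fin (quaternionRank X)) (j : Fin m) :
    reForm (P.constraintMatrix j) (v k) (v k) ≤ 0 := by
  rw [reForm, hv.form_eq, Quaternion.re_coe]
  exact div_nonpos_of_nonpos_of_nonneg (hX.1 j) (Nat.cast_nonneg _)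

theorem sum_normSq_inl_eq_one {X : Matrix (Unit ⊕ Fin n) (Unit ⊕ Fin n) ℍ[ℝ]}
    (hX : X ∈ P.relaxFeasible) {r : ℕ} {v : Fin r → Unit ⊕ Fin n → ℍ[ℝ]}
    (hv : X = ∑ k, Matrix.vecMulVec (v k) (star (v k))) :
    ∑ k, Quaternion.normSq (v k (Sum.inl ())) = 1 := by
  rw [← hX.2.1, hv, quaternionInner_sum (isHermitian_borderedMatrix _ _ Matrix.isHermitian_zero)]
  exact Finset.sum_congr rfl fun k _ => (reForm_borderedMatrix_one _).symm

theorem quaternionInner_objectiveMatrix_eq_sum {X : Matrix (Unit ⊕ Fin n) (Unit ⊕ Fin n) ℍ[ℝ]}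
    {r : ℕ} {v : Fin r → Unit ⊕ Fin n → ℍ[ℝ]}
    (hv : X = ∑ k, Matrix.vecMulVec (v k) (star (v k))) :
    quaternionInner P.objectiveMatrix X = ∑ k, reForm P.objectiveMatrix (v k) (v k) := by
  rw [hv, quaternionInner_sum P.isHermitian_objectiveMatrix]

theorem quaternionInner_objectiveMatrix_le (P : QuaternionQCQP n 4) {x₀ : Fin n → ℍ[ℝ]}
    (hx₀ : x₀ ∈ P.feasible) {V : ℝ} (hV : ∀ x ∈ P.feasible, P.objective x ≤ V)
    {X : Matrix (Unit ⊕ Fin n) (Unit ⊕ Fin n) ℍ[ℝ]} (hX : X ∈ P.relaxFeasible) :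
    quaternionInner P.objectiveMatrix X ≤ V := by
  obtain ⟨v, hv⟩ := exists_isRankOneDecomposition le_rfl P.isHermitian_constraintMatrix hX.2.2
  calc quaternionInner P.objectiveMatrix X
      = ∑ k, reForm P.objectiveMatrix (v k) (v k) :=
        P.quaternionInner_objectiveMatrix_eq_sum hv.sum_eq
    _ ≤ ∑ k, V * Quaternion.normSq (v k (Sum.inl ())) := Finset.sum_le_sum fun k _ =>
        P.reForm_objectiveMatrix_le hx₀ hV (P.reForm_nonpos_of_isRankOneDecomposition hX hv k)
    _ = V := by rw [← Finset.mul_sum, P.sum_normSq_inl_eq_one hX hv.sum_eq, mul_one]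

theorem value_eq_relaxValue (P : QuaternionQCQP n 4) (h : P.feasible.Nonempty) :
    P.value = P.relaxValue := by
  obtain ⟨x₀, hx₀⟩ := h
  apply le_antisymm
  · refine iSup₂_le fun x hx => ?_
    obtain ⟨X, hX, hXx⟩ := P.exists_relaxFeasible hx
    exact le_iSup₂_of_le X hX (by rw [hXx])
  · refine iSup₂_le fun X hX => le_of_not_gt fun hlt => ?_
    -- A real number strictly between the values covers infinite values too.
    obtain ⟨V, hV1, hV2⟩ := EReal.lt_iff_exists_real_btwn.1 hlt
    refine (EReal.coe_lt_coe_iff.1 hV2).not_ge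
      (P.quaternionInner_objectiveMatrix_le hx₀ (fun x hx => ?_) hX)
    exact EReal.coe_le_coe_iff.1 ((le_iSup₂_of_le x hx le_rfl).trans hV1.le)

/-- The vectors of a rank-one decomposition of an optimal solution of the relaxation with nonzero
first entry give optimal solutions of the QCQP. -/
theorem isOptimal_dehomogenize (P : QuaternionQCQP n 4) {x₀ : Fin n → ℍ[ℝ]}
    (hx₀ : x₀ ∈ P.feasible) {X : Matrix (Unit ⊕ Fin n) (Unit ⊕ Fin n) ℍ[ℝ]}
    (hX : P.IsRelaxOptimal X) {v : Fin (quaternionRank X) → Unit ⊕ Fin n → ℍ[ℝ]}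
    (hv : IsRankOneDecomposition P.constraintMatrix X v) (k : Fin (quaternionRank X))
    (hk : v k (Sum.inl ()) ≠ 0) : P.IsOptimal (dehomogenize (v k)) := by
  have hB := P.reForm_nonpos_of_isRankOneDecomposition hX.1 hv
  have hV (x) (hx : x ∈ P.feasible) :
      P.objective x ≤ quaternionInner P.objectiveMatrix X := by
    obtain ⟨Y, hY, hYx⟩ := P.exists_relaxFeasible hx
    exact hYx ▸ hX.2 hY
  have hle (l) := P.reForm_objectiveMatrix_le hx₀ hV (hB l)
  have hsum : ∑ l, reForm P.objectiveMatrix (v l) (v l) = ∑ l,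
      quaternionInner P.objectiveMatrix X * Quaternion.normSq (v l (Sum.inl ())) := by
    rw [← Finset.mul_sum, P.sum_normSq_inl_eq_one hX.1 hv.sum_eq, mul_one,
      P.quaternionInner_objectiveMatrix_eq_sum hv.sum_eq]
  -- Termwise inequalities with equal sums are equalities.
  have heq := (Finset.sum_eq_sum_iff_of_le fun l _ => hle l).1 hsum k (Finset.mem_univ k)
  refine ⟨P.dehomogenize_mem_feasible hk (hB k), fun x hx => ?_⟩
  change P.objective x ≤ P.objective (dehomogenize (v k))
  rw [P.objective_dehomogenize hk, heq, mul_comm,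
    mul_inv_cancel_right₀ (Quaternion.normSq_ne_zero.2 hk)]
  exact hV x hx

end

end QuaternionQCQP

theorem theorem5 {n : ℕ} (P : QuaternionQCQP n 4) (hP : P.Slater) :
    P.value = P.relaxValue ∧
    ∀ X, P.IsRelaxOptimal X →
      (∃ v, IsRankOneDecomposition P.constraintMatrix X v) ∧
      ∀ v, IsRankOneDecomposition P.constraintMatrix X v →
        (∃ k, v k (Sum.inl ()) ≠ 0) ∧
        ∀ k, v k (Sum.inl ()) ≠ 0 → P.IsOptimal (dehomogenize (v k)) := by
  obtain ⟨x₀, hx₀⟩ := hP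
  have hx₀ : x₀ ∈ P.feasible := fun j => (hx₀ j).le
  refine ⟨P.value_eq_relaxValue ⟨x₀, hx₀⟩, fun X hX =>
    ⟨QuaternionQCQP.exists_isRankOneDecomposition le_rfl P.isHermitian_constraintMatrix hX.1.2.2,
      fun v hv => ⟨?_, P.isOptimal_dehomogenize hx₀ hX hv⟩⟩⟩
  by_contra! h0
  have := P.sum_normSq_inl_eq_one hX.1 hv.sum_eq
  simp [h0] at this
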